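/- For $\tau>0$ let $\gamma:I\times[0,\tau)\to\mathbb R^2$, $I\subseteq\mathbb R$ an open interval, be a family of regular curves ($\gamma_x\neq0$) moving by curvature: $\gamma$ is $C^\infty$ on $I\times(0,\tau)$, $\gamma,\gamma_x,\gamma_{xx}$ exist and are continuous on $I\times[0,\tau)$, and $\langle\gamma_t,\nu\rangle=k$ on $I\times(0,\tau)$, where $\nu$ is the unit tangent $\gamma_x/|\gamma_x|$ rotated counterclockwise by $\pi/2$ and $k=\langle\gamma_{xx},\nu\rangle/|\gamma_x|^2$ (this includes the motion $\gamma_t=\gamma_{xx}/|\gamma_x|^2$). Write $\gamma_t$ also for the set $\gamma(I,t)$, and $B_r(x_0)$ for the open disc of radius $r$ (empty if $r=0$; if $r=\sqrt{a}$ with $a<0$ it is understood to be empty). Let $x_0\in\mathbb R^2$, $R>0$, and suppose that $\gamma_t$ is a graph over $\langle e_1\rangle$ in $B_R(x_0)$ for all $t\in[0,\tau)$: every line parallel to $e_2$ meets $\gamma_t\cap B_R(x_0)$ in at most one point, and the curves have no end points in $B_R(x_0)$, that is, for all $t_1<\tau$ and $r<R$ there is a compact $K\subset I$ with $\gamma_t\cap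 \overline{B}_r(x_0)\subseteq\gamma(K,t)$ for all $t\in[0,t_1]$. Let $v=|\langle\nu,e_2\rangle|^{-1}\in[1,\infty]$. Then for every $V<\infty$ there is a constant $C_V<\infty$, depending only on $V$, such that for all $x_0$, $R$, $\tau$ and $\gamma$ as above with $$\sup_{t\in[0,\tau)}\ \sup_{\gamma_t\cap B_R(x_0)}v\le V,$$ and for all $\theta\in(0,1)$ and $t\in[0,\tau)$, $$\sup_{\gamma_t\cap B_{\sqrt{\theta R^2-2t}}(x_0)}k^2\ \le\ \frac{C_V}{(1-\theta)^2}\left(\frac1{R^2}+\sup_{\gamma_0\cap B_R(x_0)}k^2\right),$$ where suprema over the empty set are $0$ and the right-hand side may be $+\infty$. -/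

import Mathlib

open scoped NNReal ENNReal ContDiff RealInnerProductSpace

noncomputable section

/-- The Euclidean plane. -/
abbrev Plane : Type := EuclideanSpace ℝ (Fin 2)

namespace CurveFlow

/-- Counterclockwise rotation of the plane by the angle `π / 2`. -/
def rot (w : Plane) : Plane := !₂[-(w 1), w 0]

/-- The second vector of the canonical basis. -/
def e₂ : Plane := !₂[0, 1]

/-- The spatial derivative `γ_x` of a moving curve `γ : (parameter) → (time) → Plane`. -/
def dx (γ : ℝ → ℝ → Plane) (x t : ℝ) : Plane := deriv (fun y => γ y t) x

/-- The second spatial derivative `γ_xx`. -/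
def dxx (γ : ℝ → ℝ → Plane) (x t : ℝ) : Plane := deriv (fun y => dx γ y t) x

/-- The velocity `γ_t`. -/
def dt (γ : ℝ → ℝ → Plane) (x t : ℝ) : Plane := deriv (fun s => γ x s) t

/-- The unit tangent `γ_x / |γ_x|`. -/
def tangent (γ : ℝ → ℝ → Plane) (x t : ℝ) : Plane := ‖dx γ x t‖⁻¹ • dx γ x t

/-- The unit normal, the rotated unit tangent. -/
def normal (γ : ℝ → ℝ → Plane) (x t : ℝ) : Plane := rot (tangent γ x t)

/-- The curvature `k = ⟨γ_xx, ν⟩ / |γ_x|²`. -/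
def curvature (γ : ℝ → ℝ → Plane) (x t : ℝ) : ℝ :=
  ⟪dxx γ x t, normal γ x t⟫ / ‖dx γ x t‖ ^ 2

/-- The gradient function `v = ⟨ν, e₂⟩⁻¹`, where the unit normal is chosen to point upwards (so the
absolute value is taken); for the graph of `u` it equals `√(1 + u'²)`. It takes the value `∞`
where the tangent is vertical (the inverse is that of `ℝ≥0∞`). -/
def gradientFn (γ : ℝ → ℝ → Plane) (x t : ℝ) : ℝ≥0∞ :=
  (ENNReal.ofReal |⟪normal γ x t, e₂⟫|)⁻¹

/-- The point set `γ_t`. -/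
def trace (γ : ℝ → ℝ → Plane) (I : Set ℝ) (t : ℝ) : Set Plane := (fun x => γ x t) '' I

/-- `γ : I × [0, τ) → ℝ²` is a smooth family of regular curves, parametrized by the open interval
`I`, which moves by curvature: the normal velocity is the curvature. The tangential velocity is
arbitrary, so that `γ_t = γ_xx / |γ_x|²`, `γ_t = k ν` and the evolution of graphs
`u_t = u_xx / (1 + u_x²)` (with `γ (x, t) = (x, u (x, t))`) are all included.
At the initial time the curves are only required to be attained together with their first two
spatial derivatives. -/
structure IsCurvatureFlow (γ : ℝ → ℝ → Plane) (I : Set ℝ) (τ : ℝ) : Prop where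
  isOpen : IsOpen I
  ordConnected : I.OrdConnected
  smooth : ContDiffOn ℝ ∞ (fun z : ℝ × ℝ => γ z.1 z.2) (I ×ˢ Set.Ioo 0 τ)
  contDiffOn_two : ∀ t ∈ Set.Ico 0 τ, ContDiffOn ℝ 2 (fun x => γ x t) I
  continuousOn : ContinuousOn (fun z : ℝ × ℝ => γ z.1 z.2) (I ×ˢ Set.Ico 0 τ)
  continuousOn_dx : ContinuousOn (fun z : ℝ × ℝ => dx γ z.1 z.2) (I ×ˢ Set.Ico 0 τ)
  continuousOn_dxx : ContinuousOn (fun z : ℝ × ℝ => dxx γ z.1 z.2) (I ×ˢ Set.Ico 0 τ)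
  regular : ∀ x ∈ I, ∀ t ∈ Set.Ico 0 τ, dx γ x t ≠ 0
  motion : ∀ x ∈ I, ∀ t ∈ Set.Ioo 0 τ, ⟪dt γ x t, normal γ x t⟫ = curvature γ x t

/-- `γ_t` is a graph over the first coordinate axis in the open ball `B_R(x₀)` for all
`t ∈ [0, τ)`: every vertical line meets `γ_t ∩ B_R(x₀)` at most once, and the curves have no
end point inside the ball, i.e. up to any time `t₁ < τ` the part of `γ_t` in a smaller closed
ball is covered by a fixed compact set of parameters. (If the curves extend continuously to the
closure of a bounded interval `I`, it is enough for the latter that the end points stay outside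
`B_R(x₀)`; a closed curve is given by a periodic parametrization on `ℝ`.) -/
structure IsGraphIn (γ : ℝ → ℝ → Plane) (I : Set ℝ) (τ : ℝ) (x₀ : Plane) (R : ℝ) : Prop where
  injOn : ∀ t ∈ Set.Ico 0 τ, Set.InjOn (fun w : Plane => w 0) (trace γ I t ∩ Metric.ball x₀ R)
  no_endpoint : ∀ t₁ < τ, ∀ r < R, ∃ K : Set ℝ, IsCompact K ∧ K ⊆ I ∧
    ∀ t ∈ Set.Icc 0 t₁, trace γ I t ∩ Metric.closedBall x₀ r ⊆ trace γ K t

/-- `sup_{γ_t ∩ B} k²`, as an element of `[0, ∞]`; it is `0` if `γ_t ∩ B` is empty. -/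
def supCurvatureSq (γ : ℝ → ℝ → Plane) (I : Set ℝ) (t : ℝ) (B : Set Plane) : ℝ≥0∞ :=
  ⨆ x ∈ {x ∈ I | γ x t ∈ B}, ENNReal.ofReal (curvature γ x t ^ 2)

/-- `sup_{t ∈ [0, τ)} sup_{γ_t ∩ B} v`, as an element of `[0, ∞]`. -/
def supGradientFn (γ : ℝ → ℝ → Plane) (I : Set ℝ) (τ : ℝ) (B : Set Plane) : ℝ≥0∞ :=
  ⨆ t ∈ Set.Ico 0 τ, ⨆ x ∈ {x ∈ I | γ x t ∈ B}, gradientFn γ x t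

end CurveFlow

end

/-!
The estimate is a localized maximum principle for the curvature weighted by a function of the
gradient.

Where its tangent is not vertical, the curve is locally the graph of a function `u` of the abscissa
`y = γ¹`. With `w = u_y`, `q = 1 + w² = v²` and `A = (arctan w)_y`, motion by curvature is
`u_t = A`, hence `w_t = A_y` and `q A_t = A_yy - 2 w A A_y`, and `k² = A² / q`. The derivatives at
fixed `t` and at fixed `y` are those along the vector fields `X = (1 / γ¹_x) ∂_x` and
`T = ∂_t - (γ¹_t / γ¹_x) ∂_x`, which commute (`along_comm_of_coordinates`), so neither a change of
coordinates nor a normalization of the tangential velocity is needed.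

For `v ≤ V` put `κ = 1 / (2 V²)`, `m = 1 - κ q ∈ [1/2, 1)` and `ζ = ρ - |γ - x₀|² - 2 t`. Let `M`
be the maximum of `A² ζ² / m` over `ζ ≥ 0` and over the times up to `t`; it exists since the curves
have no end points in the disc (`exists_max_weighted`), where points with several parameters are
dealt with by `graphSlope_angleRate_eq_of_eq`. If it is attained at a positive time, then
`Φ = A² ζ² + M κ w²` has a maximum there. Eliminating `A_y` from `q Φ_t - Φ_yy ≥ 0` by means of
`Φ_y = 0`, one finds that the weight `1 / m` contributes a good term of order `κ A⁴ ζ²`, which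
forces `M ≤ 640 V⁴ ρ` (`max_bound_algebra`). If it is attained at time `0`, then `M` is at most
`2 V² R⁴ k²` at a point of the initial curve. In both cases the claim follows, as
`k² ζ² ≤ A² ζ² ≤ M` and `ζ ≥ (1 - θ) R² / 2` on the smaller disc for `ρ = (1 + θ) R² / 2`. -/

noncomputable section

open Set Filter Topology

namespace CurveFlow

/-! ### Graph quantities of a curve -/

/-- The slope `w = γ²_x / γ¹_x` of the curve as a graph over the first axis, i.e. `u'` if the curve
is `y ↦ (y, u y)`. It is junk where the tangent is vertical. -/
def graphSlope (γ : ℝ → ℝ → Plane) (x t : ℝ) : ℝ := dx γ x t 1 / dx γ x t 0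

/-- The derivative `A = d(arctan u') / dy = u'' / (1 + u'²)` of the tangent angle of the graph `u`
with respect to the abscissa `y = γ¹`, in terms of an arbitrary parametrization. It is junk where
the tangent is vertical. -/
def angleRate (γ : ℝ → ℝ → Plane) (x t : ℝ) : ℝ :=
  (dx γ x t 0 * dxx γ x t 1 - dx γ x t 1 * dxx γ x t 0) /
    (dx γ x t 0 * (dx γ x t 0 ^ 2 + dx γ x t 1 ^ 2))

theorem norm_sq_plane (w : Plane) : ‖w‖ ^ 2 = w 0 ^ 2 + w 1 ^ 2 := by
  simp [EuclideanSpace.norm_sq_eq, Fin.sum_univ_two]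

theorem inner_normal (γ : ℝ → ℝ → Plane) (x t : ℝ) (w : Plane) :
    ⟪w, normal γ x t⟫ = ‖dx γ x t‖⁻¹ * (dx γ x t 0 * w 1 - dx γ x t 1 * w 0) := by
  simp [normal, rot, tangent, PiLp.inner_apply, Fin.sum_univ_two]
  ring

theorem curvature_sq_eq {γ : ℝ → ℝ → Plane} {x t : ℝ} (h : dx γ x t 0 ≠ 0) :
    curvature γ x t ^ 2 = angleRate γ x t ^ 2 / (1 + graphSlope γ x t ^ 2) := by
  have hn := norm_sq_plane (dx γ x t)
  rw [curvature, inner_normal, graphSlope, angleRate, div_pow, mul_pow, inv_pow, hn]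
  field_simp

/-- Motion by curvature in graph coordinates: the velocity of the height at a fixed abscissa is the
rate of change of the tangent angle along the abscissa, `u_t = u'' / (1 + u'²)`. -/
theorem velocity_eq {γ : ℝ → ℝ → Plane} {x t : ℝ} (h : dx γ x t 0 ≠ 0)
    (hm : ⟪dt γ x t, normal γ x t⟫ = curvature γ x t) :
    dt γ x t 1 - graphSlope γ x t * dt γ x t 0 = angleRate γ x t := by
  have hn := norm_sq_plane (dx γ x t)
  have hn0 : ‖dx γ x t‖ ≠ 0 := norm_ne_zero_iff.2 fun h0 => h (by simp [h0])
  rw [curvature, inner_normal, inner_normal, hn] at hm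
  rw [graphSlope, angleRate]
  field_simp at hm ⊢
  linear_combination hm

/-- A bound on `v` excludes vertical tangents, and `v² = 1 + w²`. -/
theorem graphSlope_bound {γ : ℝ → ℝ → Plane} {x t : ℝ} {V : ℝ≥0} (h : gradientFn γ x t ≤ V) :
    dx γ x t 0 ≠ 0 ∧ 1 + graphSlope γ x t ^ 2 ≤ (V : ℝ) ^ 2 := by
  have hn := norm_sq_plane (dx γ x t)
  rw [gradientFn, real_inner_comm, inner_normal] at h
  have h1 : ((V : ℝ≥0∞))⁻¹ ≤ ENNReal.ofReal |‖dx γ x t‖⁻¹ * dx γ x t 0| := by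
    have := ENNReal.inv_le_inv.2 h
    simpa [e₂, real_inner_comm] using this
  have hp : dx γ x t 0 ≠ 0 := by
    intro h0
    rw [h0] at h1
    simp at h1
  refine ⟨hp, ?_⟩
  have hn0 : 0 < ‖dx γ x t‖ := norm_pos_iff.2 fun h0 => hp (by simp [h0])
  have hV : V ≠ 0 := by
    rintro rfl
    rw [ENNReal.coe_zero, ENNReal.inv_zero, top_le_iff] at h1
    exact ENNReal.ofReal_ne_top h1
  have h2 : (V : ℝ)⁻¹ ≤ ‖dx γ x t‖⁻¹ * |dx γ x t 0| := by
    have h3 : ((V : ℝ≥0∞))⁻¹ = ENNReal.ofReal ((V : ℝ)⁻¹) := by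
      rw [ENNReal.ofReal_inv_of_pos (by positivity), ENNReal.ofReal_coe_nnreal]
    rw [h3, ENNReal.ofReal_le_ofReal_iff (abs_nonneg _), abs_mul, abs_inv, abs_norm] at h1
    exact h1
  have hV' : (0 : ℝ) < V := by positivity
  have h4 : ‖dx γ x t‖ ≤ V * |dx γ x t 0| := by
    rw [inv_mul_eq_div, inv_eq_one_div, div_le_div_iff₀ hV' hn0] at h2
    linarith
  have h5 : ‖dx γ x t‖ ^ 2 ≤ V ^ 2 * dx γ x t 0 ^ 2 := by
    rw [← sq_abs (dx γ x t 0), ← mul_pow]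
    gcongr
  rw [hn] at h5
  rw [graphSlope, div_pow]
  have h6 : 0 < dx γ x t 0 ^ 2 := by positivity
  rw [← sub_nonneg]
  have h7 : (V : ℝ) ^ 2 - (1 + dx γ x t 1 ^ 2 / dx γ x t 0 ^ 2)
    = (V ^ 2 * dx γ x t 0 ^ 2 - (dx γ x t 0 ^ 2 + dx γ x t 1 ^ 2)) / dx γ x t 0 ^ 2 := by
    field_simp
  rw [h7]
  apply div_nonneg <;> linarith

theorem hasDerivAt_coord {c : ℝ → Plane} {c' : Plane} {x : ℝ} (h : HasDerivAt c c' x) (i : Fin 2) :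
    HasDerivAt (fun y => c y i) (c' i) x :=
  (EuclideanSpace.proj i : Plane →L[ℝ] ℝ).hasFDerivAt.comp_hasDerivAt x h

theorem continuousOn_coord {E : Type*} [TopologicalSpace E] {f : E → Plane} {S : Set E}
    (h : ContinuousOn f S) (i : Fin 2) : ContinuousOn (fun z => f z i) S :=
  (EuclideanSpace.proj i : Plane →L[ℝ] ℝ).continuous.comp_continuousOn h

theorem contDiffAt_coord {E : Type*} [NormedAddCommGroup E] [NormedSpace ℝ E] {n : WithTop ℕ∞}
    {f : E → Plane} {z : E} (h : ContDiffAt ℝ n f z) (i : Fin 2) :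
    ContDiffAt ℝ n (fun y => f y i) z :=
  (EuclideanSpace.proj i : Plane →L[ℝ] ℝ).contDiff.contDiffAt.comp z h

theorem IsCurvatureFlow.hasDerivAt_dx {γ : ℝ → ℝ → Plane} {I : Set ℝ} {τ x t : ℝ}
    (h : IsCurvatureFlow γ I τ) (hx : x ∈ I) (ht : t ∈ Ico 0 τ) :
    HasDerivAt (fun y => γ y t) (dx γ x t) x :=
  (((h.contDiffOn_two t ht).contDiffAt (h.isOpen.mem_nhds hx)).differentiableAt
    (by norm_num)).hasDerivAt

theorem IsCurvatureFlow.hasDerivAt_dxx {γ : ℝ → ℝ → Plane} {I : Set ℝ} {τ x t : ℝ}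
    (h : IsCurvatureFlow γ I τ) (hx : x ∈ I) (ht : t ∈ Ico 0 τ) :
    HasDerivAt (fun y => dx γ y t) (dxx γ x t) x := by
  have h1 : ContDiffOn ℝ 1 (deriv fun y => γ y t) I :=
    (h.contDiffOn_two t ht).deriv_of_isOpen h.isOpen (by norm_num)
  exact ((h1.contDiffAt (h.isOpen.mem_nhds hx)).differentiableAt (by norm_num)).hasDerivAt

theorem IsCurvatureFlow.hasDerivAt_graphSlope {γ : ℝ → ℝ → Plane} {I : Set ℝ} {τ x t : ℝ}
    (h : IsCurvatureFlow γ I τ) (hx : x ∈ I) (ht : t ∈ Ico 0 τ) (hp : dx γ x t 0 ≠ 0) :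
    HasDerivAt (fun y => graphSlope γ y t)
      (dx γ x t 0 * ((1 + graphSlope γ x t ^ 2) * angleRate γ x t)) x := by
  have h2 := h.hasDerivAt_dxx hx ht
  refine ((hasDerivAt_coord h2 1).fun_div (hasDerivAt_coord h2 0) hp).congr_deriv ?_
  rw [graphSlope, angleRate]
  field_simp

/-- A point of `γ_t ∩ B_R(x₀)` with several parameters has the same slope and the same angle rate at
each of them: near two such parameters the curve is a graph over the same interval, so that by
`injOn` one piece is a reparametrization of the other. -/
theorem graphSlope_angleRate_eq_of_eq {γ : ℝ → ℝ → Plane} {I : Set ℝ} {τ t a b R : ℝ} {x₀ : Plane}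
    (h : IsCurvatureFlow γ I τ) (hg : IsGraphIn γ I τ x₀ R) (ht : t ∈ Ico 0 τ)
    (ha : a ∈ I) (hb : b ∈ I) (hab : γ a t = γ b t) (hball : γ b t ∈ Metric.ball x₀ R)
    (hpa : dx γ a t 0 ≠ 0) (hpb : dx γ b t 0 ≠ 0) :
    graphSlope γ a t = graphSlope γ b t ∧ angleRate γ a t = angleRate γ b t := by
  set ξ : ℝ → ℝ := fun y => γ y t 0 with hξ
  have hca : ContDiffAt ℝ 2 ξ a :=
    contDiffAt_coord ((h.contDiffOn_two t ht).contDiffAt (h.isOpen.mem_nhds ha)) 0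
  have hcb : ContDiffAt ℝ 2 ξ b :=
    contDiffAt_coord ((h.contDiffOn_two t ht).contDiffAt (h.isOpen.mem_nhds hb)) 0
  have hda : HasDerivAt ξ (dx γ a t 0) a := hasDerivAt_coord (h.hasDerivAt_dx ha ht) 0
  let e : ℝ ≃L[ℝ] ℝ := ContinuousLinearEquiv.unitsEquivAut ℝ (Units.mk0 _ hpa)
  have hfa : HasFDerivAt ξ (e : ℝ →L[ℝ] ℝ) a := by
    have he : (e : ℝ →L[ℝ] ℝ) = ContinuousLinearMap.toSpanSingleton ℝ (dx γ a t 0) := by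
      ext
      simp [e]
    rw [he]
    exact hda.hasFDerivAt
  have hli := hca.to_localInverse hfa (by norm_num)
  have hsa := hca.hasStrictFDerivAt' hfa (by norm_num)
  set ψ : ℝ → ℝ := hca.localInverse hfa (by norm_num)
  have hξab : ξ a = ξ b := by simp only [hξ, hab]
  rw [hξab] at hli
  have hinv : ∀ᶠ s in 𝓝 (ξ b), ξ (ψ s) = s := by
    rw [← hξab]
    exact hsa.eventually_right_inverse
  have hψb : ψ (ξ b) = a := by
    rw [← hξab]
    exact hsa.localInverse_apply_image
  -- the reparametrization: `φ y`, close to `a`, has the same abscissa as `y`, close to `b`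
  set φ : ℝ → ℝ := fun y => ψ (ξ y)
  have hφb : φ b = a := hψb
  have hφC : ContDiffAt ℝ 2 φ b := hli.comp b hcb
  have hcontγ : ∀ c ∈ I, ContinuousAt (fun y => γ y t) c := fun c hc =>
    (h.hasDerivAt_dx hc ht).continuousAt
  have hφI : ∀ᶠ y in 𝓝 b, φ y ∈ I := by
    apply hφC.continuousAt
    rw [hφb]
    exact h.isOpen.mem_nhds ha
  have hφball : ∀ᶠ y in 𝓝 b, γ (φ y) t ∈ Metric.ball x₀ R := by
    have : ContinuousAt (fun y => γ (φ y) t) b := by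
      apply ContinuousAt.comp (g := fun y => γ y t) _ hφC.continuousAt
      rw [hφb]
      exact hcontγ a ha
    apply this
    apply Metric.isOpen_ball.mem_nhds
    simp only [hφb, hab]
    exact hball
  have hyball : ∀ᶠ y in 𝓝 b, γ y t ∈ Metric.ball x₀ R :=
    hcontγ b hb (Metric.isOpen_ball.mem_nhds hball)
  have hEq : ∀ᶠ y in 𝓝 b, γ (φ y) t = γ y t := by
    filter_upwards [hφI, hφball, hyball, h.isOpen.mem_nhds hb,
      hcb.continuousAt.eventually hinv] with y h1 h2 h3 h4 h5
    exact hg.injOn t ht ⟨mem_image_of_mem _ h1, h2⟩ ⟨mem_image_of_mem _ h4, h3⟩ h5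
  have hφd : ∀ᶠ y in 𝓝 b, DifferentiableAt ℝ φ y :=
    (hφC.eventually (by norm_num)).mono fun y hy => hy.differentiableAt (by norm_num)
  have hdx : ∀ᶠ y in 𝓝 b, dx γ y t = deriv φ y • dx γ (φ y) t := by
    filter_upwards [hEq.eventually_nhds, hφd, hφI, h.isOpen.mem_nhds hb] with y h1 h2 h3 h4
    have h5 : HasDerivAt (fun y => γ (φ y) t) (deriv φ y • dx γ (φ y) t) y :=
      (h.hasDerivAt_dx h3 ht).scomp y h2.hasDerivAt
    exact (h.hasDerivAt_dx h4 ht).unique (h5.congr_of_eventuallyEq (h1.mono fun _ hz => hz.symm))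
  have hpc : ∀ᶠ y in 𝓝 b, dx γ y t 0 ≠ 0 :=
    (hasDerivAt_coord (h.hasDerivAt_dxx hb ht) 0).continuousAt.eventually_ne hpb
  have hslope : ∀ᶠ y in 𝓝 b, graphSlope γ (φ y) t = graphSlope γ y t := by
    filter_upwards [hdx, hpc] with y h1 h2
    rw [graphSlope, graphSlope, h1]
    rw [h1] at h2
    simp only [PiLp.smul_apply, smul_eq_mul] at h2 ⊢
    rw [mul_div_mul_left _ _ (left_ne_zero_of_mul h2)]
  have hs : graphSlope γ a t = graphSlope γ b t := by
    have := hslope.self_of_nhds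
    rwa [hφb] at this
  refine ⟨hs, ?_⟩
  have hda' : HasDerivAt (fun y => graphSlope γ y t)
      (dx γ a t 0 * ((1 + graphSlope γ a t ^ 2) * angleRate γ a t)) (φ b) := by
    rw [hφb]
    exact h.hasDerivAt_graphSlope ha ht hpa
  have h1 := (h.hasDerivAt_graphSlope hb ht hpb).unique
    ((hda'.comp b hφd.self_of_nhds.hasDerivAt).congr_of_eventuallyEq
      (hslope.mono fun _ hz => hz.symm))
  have h2 := congrArg (fun w : Plane => w 0) hdx.self_of_nhds
  simp only [PiLp.smul_apply, smul_eq_mul, hφb] at h2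
  rw [hs] at h1
  have h3 : (dx γ b t 0 * (1 + graphSlope γ b t ^ 2)) * angleRate γ b t =
      (dx γ b t 0 * (1 + graphSlope γ b t ^ 2)) * angleRate γ a t := by
    linear_combination h1 - (1 + graphSlope γ b t ^ 2) * angleRate γ a t * h2
  exact (mul_left_cancel₀ (mul_ne_zero hpb (by positivity)) h3).symm

/-! ### Necessary conditions at a maximum, and derivatives along vector fields -/

theorem deriv_deriv_nonpos_of_isLocalMax {f : ℝ → ℝ} {x : ℝ} (h : IsLocalMax f x)
    (hc : ContinuousAt f x) : deriv (deriv f) x ≤ 0 := by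
  by_contra! hpos
  have hmin := isLocalMin_of_deriv_deriv_pos hpos h.deriv_eq_zero hc
  have hcon : f =ᶠ[𝓝 x] fun _ => f x := by
    filter_upwards [h, hmin] with y h1 h2 using le_antisymm h1 h2
  have : deriv (deriv f) x = 0 := by
    rw [hcon.deriv.deriv_eq]
    simp
  linarith

/-- The one-sided condition is what a maximum over `[0, t]` gives at its final time. -/
theorem deriv_nonneg_of_left_max {f : ℝ → ℝ} {f' t : ℝ} (h : HasDerivAt f f' t)
    (hmax : ∀ᶠ s in 𝓝 t, s ≤ t → f s ≤ f t) : 0 ≤ f' := by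
  have h1 : Tendsto (slope f t) (𝓝[<] t) (𝓝 f') :=
    (hasDerivAt_iff_tendsto_slope.1 h).mono_left (nhdsWithin_mono _ fun y hy => ne_of_lt hy)
  refine ge_of_tendsto h1 ?_
  filter_upwards [self_mem_nhdsWithin, hmax.filter_mono nhdsWithin_le_nhds] with s hs h2
  have hs' : s < t := hs
  rw [slope_def_field]
  exact div_nonneg_of_nonpos (by linarith [h2 hs'.le]) (by linarith)

/-- The derivative of `f` along the vector field `X` of space-time. -/
def along (X : ℝ × ℝ → ℝ × ℝ) (f : ℝ × ℝ → ℝ) (z : ℝ × ℝ) : ℝ := fderiv ℝ f z (X z)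

section along
variable {Ω : Set (ℝ × ℝ)} {X T : ℝ × ℝ → ℝ × ℝ} {f g : ℝ × ℝ → ℝ} {z : ℝ × ℝ}

theorem contDiffOn_along (hΩ : IsOpen Ω) (hX : ContDiffOn ℝ ∞ X Ω) (hf : ContDiffOn ℝ ∞ f Ω) :
    ContDiffOn ℝ ∞ (along X f) Ω :=
  (hf.fderiv_of_isOpen hΩ (by norm_num)).clm_apply hX

theorem differentiableAt_of_smooth (hΩ : IsOpen Ω) (hf : ContDiffOn ℝ ∞ f Ω) (hz : z ∈ Ω) :
    DifferentiableAt ℝ f z :=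
  (hf.contDiffAt (hΩ.mem_nhds hz)).differentiableAt (by norm_num)

theorem along_congr (hΩ : IsOpen Ω) (h : ∀ z ∈ Ω, f z = g z) (hz : z ∈ Ω) :
    along X f z = along X g z := by
  have : f =ᶠ[𝓝 z] g := by
    filter_upwards [hΩ.mem_nhds hz] with y hy using h y hy
  rw [along, along, this.fderiv_eq]

theorem along_comm (hΩ : IsOpen Ω) (hX : ContDiffOn ℝ ∞ X Ω) (hT : ContDiffOn ℝ ∞ T Ω)
    (hf : ContDiffOn ℝ ∞ f Ω) (hz : z ∈ Ω) :
    along X (along T f) z - along T (along X f) z =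
      fderiv ℝ f z (fderiv ℝ T z (X z) - fderiv ℝ X z (T z)) := by
  have hfz := hf.contDiffAt (hΩ.mem_nhds hz)
  have hd : DifferentiableAt ℝ (fderiv ℝ f) z :=
    (hfz.fderiv_right (m := ∞) (by norm_num)).differentiableAt (by norm_num)
  have hXd : DifferentiableAt ℝ X z :=
    (hX.contDiffAt (hΩ.mem_nhds hz)).differentiableAt (by norm_num)
  have hTd : DifferentiableAt ℝ T z :=
    (hT.contDiffAt (hΩ.mem_nhds hz)).differentiableAt (by norm_num)
  have hsymm : IsSymmSndFDerivAt ℝ f z := hfz.isSymmSndFDerivAt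
    (by simpa using WithTop.coe_le_coe.2 (le_top : (2 : ℕ∞) ≤ ⊤))
  have e1 : fderiv ℝ (along T f) z (X z) =
      fderiv ℝ (fderiv ℝ f) z (X z) (T z) + fderiv ℝ f z (fderiv ℝ T z (X z)) := by
    rw [show along T f = fun y => (fderiv ℝ f y) (T y) from rfl, fderiv_clm_apply hd hTd]
    simp [add_comm]
  have e2 : fderiv ℝ (along X f) z (T z) =
      fderiv ℝ (fderiv ℝ f) z (T z) (X z) + fderiv ℝ f z (fderiv ℝ X z (T z)) := by
    rw [show along X f = fun y => (fderiv ℝ f y) (X y) from rfl, fderiv_clm_apply hd hXd]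
    simp [add_comm]
  rw [along, along, e1, e2, hsymm.eq, map_sub]
  ring

/-- Vector fields `X` and `T` dual to coordinates `(y, t)` of space-time commute: their bracket
annihilates both coordinates. Here `X` is horizontal, so `X y = 1` makes `dy` injective on
horizontal vectors. -/
theorem along_comm_of_coordinates (hΩ : IsOpen Ω) (hX : ContDiffOn ℝ ∞ X Ω)
    (hT : ContDiffOn ℝ ∞ T Ω) {y : ℝ × ℝ → ℝ} (hy : ContDiffOn ℝ ∞ y Ω)
    (hXy : ∀ z ∈ Ω, along X y z = 1) (hTy : ∀ z ∈ Ω, along T y z = 0)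
    (hX2 : ∀ z ∈ Ω, (X z).2 = 0) (hT2 : ∀ z ∈ Ω, (T z).2 = 1)
    (hf : ContDiffOn ℝ ∞ f Ω) (hz : z ∈ Ω) :
    along X (along T f) z = along T (along X f) z := by
  have key := fun {g} (hg : ContDiffOn ℝ ∞ g Ω) => along_comm (f := g) hΩ hX hT hg hz
  have hconst : ∀ (Y : ℝ × ℝ → ℝ × ℝ) (c : ℝ), along Y (fun _ => c) z = 0 := by
    intro Y c
    simp [along]
  have h1 := key hy
  have h2 := key (contDiff_snd.contDiffOn (s := Ω))
  rw [along_congr hΩ hTy hz, along_congr hΩ hXy hz, hconst, hconst] at h1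
  have hs : ∀ (Y : ℝ × ℝ → ℝ × ℝ) (z : ℝ × ℝ), along Y Prod.snd z = (Y z).2 := by
    intro Y z
    simp [along, fderiv_snd]
  rw [along_congr (g := fun _ => 1) hΩ (fun z hz => (hs T z).trans (hT2 z hz)) hz,
    along_congr (g := fun _ => 0) hΩ (fun z hz => (hs X z).trans (hX2 z hz)) hz,
    hconst, hconst] at h2
  rw [fderiv_snd] at h2
  set B := fderiv ℝ T z (X z) - fderiv ℝ X z (T z)
  have hB2 : B.2 = 0 := by simpa using h2.symm
  have hXz : X z = (X z).1 • ((1 : ℝ), (0 : ℝ)) := by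
    ext
    · simp
    · simp [hX2 z hz]
  have hBz : B = B.1 • ((1 : ℝ), (0 : ℝ)) := by
    ext
    · simp
    · simp [hB2]
  have hy1 := hXy z hz
  rw [along, hXz, map_smul, smul_eq_mul] at hy1
  rw [hBz, map_smul, smul_eq_mul] at h1
  have hB1 : B.1 = 0 := by
    rcases mul_eq_zero.1 (h1.symm.trans (sub_self 0)) with h | h
    · exact h
    · rw [h] at hy1
      simp at hy1
  have hB0 : B = 0 := Prod.ext hB1 hB2
  have := key hf
  rw [hB0, map_zero] at this
  linarith

/-- `f` is differentiable at `z` with derivative `d` along `X`; the predicate allows derivatives of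
compound functions to be read off from their parts. -/
def HasAlong (X : ℝ × ℝ → ℝ × ℝ) (f : ℝ × ℝ → ℝ) (d : ℝ) (z : ℝ × ℝ) : Prop :=
  DifferentiableAt ℝ f z ∧ along X f z = d

variable {a b : ℝ}

theorem hasAlong_const (c : ℝ) : HasAlong X (fun _ => c) 0 z :=
  ⟨differentiableAt_const c, by simp [along]⟩

theorem hasAlong_snd : HasAlong X Prod.snd (X z).2 z :=
  ⟨differentiableAt_snd, by simp [along, fderiv_snd]⟩

theorem HasAlong.add (hf : HasAlong X f a z) (hg : HasAlong X g b z) :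
    HasAlong X (fun z => f z + g z) (a + b) z := by
  refine ⟨hf.1.add hg.1, ?_⟩
  rw [along, fderiv_fun_add hf.1 hg.1, ← hf.2, ← hg.2]
  simp [along]

theorem HasAlong.sub (hf : HasAlong X f a z) (hg : HasAlong X g b z) :
    HasAlong X (fun z => f z - g z) (a - b) z := by
  refine ⟨hf.1.sub hg.1, ?_⟩
  rw [along, fderiv_fun_sub hf.1 hg.1, ← hf.2, ← hg.2]
  simp [along]

theorem HasAlong.mul (hf : HasAlong X f a z) (hg : HasAlong X g b z) :
    HasAlong X (fun z => f z * g z) (a * g z + f z * b) z := by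
  refine ⟨hf.1.mul hg.1, ?_⟩
  rw [along, fderiv_fun_mul hf.1 hg.1, ← hf.2, ← hg.2]
  simp [along]
  ring

theorem hasAlong_of_smooth (hΩ : IsOpen Ω) (hf : ContDiffOn ℝ ∞ f Ω) (hz : z ∈ Ω)
    (h : along X f z = a) : HasAlong X f a z :=
  ⟨differentiableAt_of_smooth hΩ hf hz, h⟩

theorem hasDerivAt_horizontal {s t : ℝ} (hf : DifferentiableAt ℝ f (s, t)) :
    HasDerivAt (fun s => f (s, t)) (fderiv ℝ f (s, t) (1, 0)) s :=
  hf.hasFDerivAt.comp_hasDerivAt s ((hasDerivAt_id s).prodMk (hasDerivAt_const s t))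

theorem hasDerivAt_vertical {s t : ℝ} (hf : DifferentiableAt ℝ f (s, t)) :
    HasDerivAt (fun t => f (s, t)) (fderiv ℝ f (s, t) (0, 1)) t :=
  hf.hasFDerivAt.comp_hasDerivAt t ((hasDerivAt_const t s).prodMk (hasDerivAt_id t))

theorem along_eq_horizontal (hX2 : (X z).2 = 0) :
    along X f z = (X z).1 * along (fun _ => (1, 0)) f z := by
  have : X z = (X z).1 • ((1 : ℝ), (0 : ℝ)) := by
    ext
    · simp
    · simp [hX2]
  rw [along, this, map_smul, smul_eq_mul, along]
  simp

/-- At a maximum in space the derivatives of first and second order along a horizontal field obey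
the usual conditions: the field being a multiple of `∂_x`, the terms with its derivative vanish. -/
theorem along_conditions_of_isLocalMax (hΩ : IsOpen Ω) (hX : ContDiffOn ℝ ∞ X Ω)
    (hX2 : ∀ z ∈ Ω, (X z).2 = 0) (hf : ContDiffOn ℝ ∞ f Ω) (hz : z ∈ Ω)
    (hmax : IsLocalMax (fun s => f (s, z.2)) z.1) :
    fderiv ℝ f z (1, 0) = 0 ∧ along X f z = 0 ∧ along X (along X f) z ≤ 0 := by
  set E : ℝ × ℝ → ℝ × ℝ := fun _ => (1, 0)
  have hEf : ContDiffOn ℝ ∞ (along E f) Ω := contDiffOn_along hΩ contDiffOn_const hf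
  have hd := hasDerivAt_horizontal (differentiableAt_of_smooth hΩ hf hz)
  have h0 : along E f z = 0 := hmax.hasDerivAt_eq_zero hd
  have hline : ∀ᶠ s in 𝓝 z.1, (s, z.2) ∈ Ω :=
    (show ContinuousAt (fun s => (s, z.2)) z.1 by fun_prop).eventually (hΩ.mem_nhds hz)
  have hder : deriv (fun s => f (s, z.2)) =ᶠ[𝓝 z.1] fun s => along E f (s, z.2) :=
    hline.mono fun s hs => (hasDerivAt_horizontal (differentiableAt_of_smooth hΩ hf hs)).deriv
  have h2 : along E (along E f) z ≤ 0 := by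
    have h3 := deriv_deriv_nonpos_of_isLocalMax hmax hd.continuousAt
    rwa [hder.deriv_eq,
      (hasDerivAt_horizontal (differentiableAt_of_smooth hΩ hEf hz)).deriv] at h3
  refine ⟨h0, by rw [along_eq_horizontal (hX2 z hz), h0, mul_zero], ?_⟩
  have hX1 : DifferentiableAt ℝ (fun z => (X z).1) z :=
    ((hX.contDiffAt (hΩ.mem_nhds hz)).differentiableAt (by norm_num)).fst
  have h4 : HasAlong X (fun z => (X z).1 * along E f z) _ z :=
    HasAlong.mul ⟨hX1, rfl⟩ ⟨differentiableAt_of_smooth hΩ hEf hz, rfl⟩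
  rw [along_congr hΩ (fun z hz => along_eq_horizontal (hX2 z hz)) hz, h4.2, h0, mul_zero, zero_add,
    along_eq_horizontal (hX2 z hz), ← mul_assoc]
  exact mul_nonpos_of_nonneg_of_nonpos (mul_self_nonneg _) h2

theorem along_nonneg_of_left_max (hT2 : (T z).2 = 1) (hf : DifferentiableAt ℝ f z)
    (h0 : fderiv ℝ f z (1, 0) = 0)
    (hmax : ∀ᶠ s in 𝓝 z.2, s ≤ z.2 → f (z.1, s) ≤ f z) : 0 ≤ along T f z := by
  have h1 := deriv_nonneg_of_left_max (hasDerivAt_vertical hf) hmax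
  have : T z = (T z).1 • ((1 : ℝ), (0 : ℝ)) + (0, 1) := by
    ext
    · simp
    · simp [hT2]
  rw [along, this, map_add, map_smul, h0, smul_zero, zero_add]
  exact h1

end along

/-! ### The maximum principle in graph coordinates -/

/-- The term `2 P Y w (1 + β)` is absorbed by the left-hand side after multiplication by `β q`. -/
theorem absorb_cross_term {w q P Y β : ℝ} (hw : w ^ 2 = q - 1) (hq0 : 0 < q) (hβ0 : 0 < β)
    (hβ1 : β ≤ 1)
    (h5 : P ^ 2 * (β * q + β ^ 2 * w ^ 2) ≤ 2 * Y ^ 2 + 2 * P * Y * w * (1 + β)) :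
    (β * q * P) ^ 2 ≤ 20 * q * Y ^ 2 := by
  have a1 : β * q * P ^ 2 ≤ 2 * Y ^ 2 + 2 * P * Y * w * (1 + β) := by
    linarith [mul_nonneg (sq_nonneg P) (mul_nonneg (sq_nonneg β) (sq_nonneg w))]
  have a2 := mul_le_mul_of_nonneg_left a1 (mul_pos hβ0 hq0).le
  have a3 := sq_nonneg (β * q * P - 2 * (Y * w * (1 + β)))
  have a4 : (1 + β) ^ 2 ≤ 4 := by
    calc (1 + β) ^ 2 ≤ (1 + 1) ^ 2 := by gcongr
      _ = 4 := by norm_num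
  have a5 : Y ^ 2 * w ^ 2 * (1 + β) ^ 2 ≤ Y ^ 2 * q * 4 := by
    gcongr
    linarith
  have a6 : β * (q * Y ^ 2) ≤ 1 * (q * Y ^ 2) := by gcongr
  linarith

/-- The algebra of the maximum principle at a point where `Φ = A² ζ² + M κ w²` has a maximum with
`A² ζ² = M (1 - κ q)`, `q = 1 + w²`. The numbers are the values there of the quantities of the same
name, `A₁`, `A₂`, `ζ₁` being derivatives along the abscissa and `δA` the time derivative at a fixed
abscissa. The hypotheses `h1`, `h2` and `h3` say that `Φ' = 0`, `Φ'' ≤ 0` and `Φ_t ≥ 0`. -/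
theorem max_bound_algebra {V κ ρ M w q A A₁ A₂ ζ y u δA ζ₁ : ℝ} (hw : w ^ 2 = q - 1)
    (hq : q ≤ V ^ 2)
    (hκ : κ * (2 * V ^ 2) = 1) (hM : 0 < M) (hζ : 0 < ζ) (hρ : y ^ 2 + u ^ 2 ≤ ρ)
    (hval : A ^ 2 * ζ ^ 2 = M * (1 - κ * q))
    (hδA : q * δA = A₂ - 2 * w * A * A₁)
    (hζ₁ : ζ₁ = -2 * (y + u * w))
    (h1 : 2 * A * A₁ * ζ ^ 2 + 2 * A ^ 2 * ζ * ζ₁ + 2 * M * κ * w * (q * A) = 0)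
    (h2 : 2 * A₁ ^ 2 * ζ ^ 2 + 2 * A * A₂ * ζ ^ 2 + 8 * A * A₁ * ζ * ζ₁ + 2 * A ^ 2 * ζ₁ ^ 2 +
      2 * A ^ 2 * ζ * (-2 * (q + u * (q * A))) +
      2 * M * κ * ((q * A) ^ 2 + 2 * w ^ 2 * q * A ^ 2 + w * q * A₁) ≤ 0)
    (h3 : 0 ≤ 2 * A * δA * ζ ^ 2 + 2 * A ^ 2 * ζ * (-2 * u * A - 2) + 2 * M * κ * w * A₁) :
    M ≤ 640 * V ^ 4 * ρ := by
  have hq1 : 1 ≤ q := by linarith [sq_nonneg w]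
  have hq0 : 0 < q := by linarith
  have hκ0 : 0 < κ := by
    by_contra! h
    linarith [mul_nonneg (neg_nonneg.2 h) (by positivity : 0 ≤ 2 * V ^ 2)]
  have hκq : κ * q ≤ 1 / 2 := by linarith [mul_le_mul_of_nonneg_left hq hκ0.le]
  obtain ⟨m, hm⟩ : ∃ m, m = 1 - κ * q := ⟨_, rfl⟩
  rw [← hm] at hval
  have hm2 : 1 / 2 ≤ m := by linarith
  have hm0 : 0 < m := by linarith
  have hA : A ≠ 0 := by
    rintro rfl
    have : 0 < M * m := by positivity
    rw [← hval] at this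
    norm_num at this
  -- the first-order condition, divided by `2 A`
  have h1' : A₁ * ζ ^ 2 + A * ζ * ζ₁ + M * κ * w * q = 0 := by
    have : (2 * A) * (A₁ * ζ ^ 2 + A * ζ * ζ₁ + M * κ * w * q) = 0 := by linear_combination h1
    exact (mul_eq_zero.1 this).resolve_left (by positivity)
  -- the heat operator `q ∂_t - ∂_y²` applied to `Φ`, divided by `2`
  have h4 : 0 ≤ ζ ^ 2 * (-2 * w * A ^ 2 * A₁ - A₁ ^ 2) - A ^ 2 * ζ₁ ^ 2 - 4 * A * A₁ * ζ * ζ₁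
      - M * κ * A ^ 2 * q * (3 * q - 2) := by
    have e : q * (2 * A * δA * ζ ^ 2 + 2 * A ^ 2 * ζ * (-2 * u * A - 2) + 2 * M * κ * w * A₁) -
        (2 * A₁ ^ 2 * ζ ^ 2 + 2 * A * A₂ * ζ ^ 2 + 8 * A * A₁ * ζ * ζ₁ + 2 * A ^ 2 * ζ₁ ^ 2 +
      2 * A ^ 2 * ζ * (-2 * (q + u * (q * A))) +
      2 * M * κ * ((q * A) ^ 2 + 2 * w ^ 2 * q * A ^ 2 + w * q * A₁)) =
      2 * (ζ ^ 2 * (-2 * w * A ^ 2 * A₁ - A₁ ^ 2) - A ^ 2 * ζ₁ ^ 2 - 4 * A * A₁ * ζ * ζ₁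
      - M * κ * A ^ 2 * q * (3 * q - 2)) := by
      linear_combination 2 * A * ζ ^ 2 * hδA - 4 * M * κ * q * A ^ 2 * hw
    linarith [mul_nonneg hq0.le h3]
  obtain ⟨P, hP⟩ : ∃ P, P = A ^ 2 * ζ := ⟨_, rfl⟩
  obtain ⟨Y, hY⟩ : ∃ Y, Y = A * ζ₁ := ⟨_, rfl⟩
  obtain ⟨β, hβ⟩ : ∃ β, β = κ * q / m := ⟨_, rfl⟩
  have hβm : β * m = κ * q := by rw [hβ]; field_simp
  have hMβ : M * κ * q = A * A * ζ ^ 2 * β := by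
    linear_combination -M * hβm - β * hval
  -- the first-order condition eliminates `A₁`
  have hX : A₁ * ζ = -Y - P * β * w := by
    have : ζ * (A₁ * ζ) = ζ * (-Y - P * β * w) := by
      rw [hY, hP]
      linear_combination h1' - w * hMβ
    exact mul_left_cancel₀ hζ.ne' this
  -- the good term on the left comes from `κ`: for `κ = 0` it would vanish
  have h5 : P ^ 2 * (β * q + β ^ 2 * w ^ 2) ≤ 2 * Y ^ 2 + 2 * P * Y * w * (1 + β) := by
    have e : ζ ^ 2 * (-2 * w * A ^ 2 * A₁ - A₁ ^ 2) - A ^ 2 * ζ₁ ^ 2 - 4 * A * A₁ * ζ * ζ₁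
      - M * κ * A ^ 2 * q * (3 * q - 2) =
      -2 * w * P * (A₁ * ζ) - (A₁ * ζ) ^ 2 - Y ^ 2 - 4 * (A₁ * ζ) * Y
        - P ^ 2 * β * (3 * q - 2) := by
      rw [hP, hY]
      linear_combination -(A ^ 2) * (3 * q - 2) * hMβ
    rw [e, hX] at h4
    have e2 : -2 * w * P * (-Y - P * β * w) - (-Y - P * β * w) ^ 2 - Y ^ 2
        - 4 * (-Y - P * β * w) * Y - P ^ 2 * β * (3 * q - 2) =
        2 * Y ^ 2 + 2 * P * Y * w * (1 + β) - P ^ 2 * (β * q + β ^ 2 * w ^ 2) := by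
      linear_combination (2 * P ^ 2 * β) * hw
    linarith
  have hβκ : κ * q ≤ β := by
    rw [hβ, le_div_iff₀ hm0]
    have : m ≤ 1 := by rw [hm]; linarith [mul_pos hκ0 hq0]
    exact mul_le_of_le_one_right (by positivity) this
  have hβ0 : 0 < β := lt_of_lt_of_le (by positivity) hβκ
  have hβ1 : β ≤ 1 := by
    rw [hβ, div_le_one hm0]
    linarith
  have h6 : (β * q * P) ^ 2 ≤ 20 * q * Y ^ 2 := absorb_cross_term hw hq0 hβ0 hβ1 h5
  have h7 : Y ^ 2 ≤ 4 * A ^ 2 * (ρ * q) := by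
    have b1 : (y + u * w) ^ 2 ≤ (y ^ 2 + u ^ 2) * q := by
      rw [show q = 1 + w ^ 2 by linarith]
      linarith [sq_nonneg (y * w - u)]
    have b2 : (y ^ 2 + u ^ 2) * q ≤ ρ * q := by gcongr
    have b3 := mul_le_mul_of_nonneg_left (b1.trans b2) (by positivity : 0 ≤ 4 * A ^ 2)
    rw [hY, hζ₁]
    linarith
  have h8 : κ ^ 2 * (A ^ 2 * ζ ^ 2) ≤ 80 * ρ := by
    have c1 : (κ * q * q * P) ^ 2 ≤ (β * q * P) ^ 2 := by
      rw [hP]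
      gcongr
    have c2 : A ^ 2 * q ^ 2 * (κ ^ 2 * (A ^ 2 * ζ ^ 2) * q ^ 2) ≤ A ^ 2 * q ^ 2 * (80 * ρ) := by
      have := mul_le_mul_of_nonneg_left h7 (by positivity : 0 ≤ 20 * q)
      rw [hP] at c1 h6
      linarith
    have c3 := le_of_mul_le_mul_left c2 (by positivity)
    have c4 : 1 ≤ q ^ 2 := one_le_pow₀ hq1
    exact (le_mul_of_one_le_right (by positivity) c4).trans c3
  have h9 : κ ^ 2 * M ≤ 160 * ρ := by
    rw [hval] at h8
    have := mul_le_mul_of_nonneg_left hm2 (by positivity : 0 ≤ κ ^ 2 * M)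
    linarith
  have h10 := mul_le_mul_of_nonneg_left h9 (by positivity : 0 ≤ 4 * V ^ 4)
  have h11 : 4 * V ^ 4 * (κ ^ 2 * M) = M := by
    linear_combination M * (κ * (2 * V ^ 2) + 1) * hκ
  linarith

/-- The bound at an interior maximum for abstract coordinate functions: `X = ∂_y` and `T = ∂_t` are
the fields dual to the coordinates `(y, t)`, `u` is the height, with `u_y = w`, and `u_t = A` is
the equation of motion. The maximum is only required over times not after that of `z`. -/
theorem interior_max_bound {Ω : Set (ℝ × ℝ)} {X T : ℝ × ℝ → ℝ × ℝ} {y u w A ζ : ℝ × ℝ → ℝ}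
    {z : ℝ × ℝ} {M V κ ρ : ℝ} (hΩ : IsOpen Ω) (hX : ContDiffOn ℝ ∞ X Ω)
    (hT : ContDiffOn ℝ ∞ T Ω) (hy : ContDiffOn ℝ ∞ y Ω) (hu : ContDiffOn ℝ ∞ u Ω)
    (hw : ContDiffOn ℝ ∞ w Ω) (hA : ContDiffOn ℝ ∞ A Ω)
    (hXy : ∀ z ∈ Ω, along X y z = 1) (hTy : ∀ z ∈ Ω, along T y z = 0)
    (hX2 : ∀ z ∈ Ω, (X z).2 = 0) (hT2 : ∀ z ∈ Ω, (T z).2 = 1)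
    (hXu : ∀ z ∈ Ω, along X u z = w z) (hTu : ∀ z ∈ Ω, along T u z = A z)
    (hXw : ∀ z ∈ Ω, along X w z = (1 + w z * w z) * A z)
    (hζ : ∀ z, ζ z = ρ - y z * y z - u z * u z - 2 * z.2)
    (hz : z ∈ Ω) (hz2 : 0 ≤ z.2) (hq : 1 + w z ^ 2 ≤ V ^ 2) (hκ : κ * (2 * V ^ 2) = 1)
    (hM : 0 < M) (hζ0 : 0 < ζ z)
    (hval : A z ^ 2 * ζ z ^ 2 = M * (1 - κ * (1 + w z ^ 2)))
    (hmax : ∀ᶠ z' in 𝓝 z, z'.2 ≤ z.2 →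
      A z' ^ 2 * ζ z' ^ 2 ≤ M * (1 - κ * (1 + w z' ^ 2))) :
    M ≤ 640 * V ^ 4 * ρ := by
  obtain rfl : ζ = fun z => ρ - y z * y z - u z * u z - 2 * z.2 := funext hζ
  have hcomm := fun {f z} (hf : ContDiffOn ℝ ∞ f Ω) (hz : z ∈ Ω) =>
    along_comm_of_coordinates hΩ hX hT hy hXy hTy hX2 hT2 hf hz
  have hA₁ : ContDiffOn ℝ ∞ (along X A) Ω := contDiffOn_along hΩ hX hA
  have sm := fun {Y f a z} => hasAlong_of_smooth (Ω := Ω) (X := Y) (f := f) (z := z) (a := a) hΩ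
  -- evolution equations of the slope and of the angle rate, from `[X, T] = 0`
  have hTw : ∀ z ∈ Ω, along T w z = along X A z := fun z hz => by
    rw [← along_congr hΩ hXu hz, ← hcomm hu hz, along_congr hΩ hTu hz]
  have hTA : (1 + w z ^ 2) * along T A z = along X (along X A) z - 2 * w z * A z * along X A z := by
    have h1 := hcomm hw hz
    rw [along_congr hΩ hTw hz, along_congr hΩ hXw hz] at h1
    have h2 := ((hasAlong_const 1).add ((sm hw hz (hTw z hz)).mul (sm hw hz (hTw z hz)))).mul
      (sm (Y := T) hA hz rfl)
    rw [h2.2] at h1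
    linear_combination -h1
  have hXζ : ∀ z ∈ Ω, HasAlong X (fun z => ρ - y z * y z - u z * u z - 2 * z.2)
      (-2 * (y z + u z * w z)) z := fun z hz => by
    have := (((hasAlong_const (X := X) (z := z) ρ).sub
      ((sm hy hz (hXy z hz)).mul (sm hy hz (hXy z hz)))).sub
      ((sm hu hz (hXu z hz)).mul (sm hu hz (hXu z hz)))).sub ((hasAlong_const 2).mul hasAlong_snd)
    refine ⟨this.1, this.2.trans ?_⟩
    rw [hX2 z hz]
    ring
  have hTζ : HasAlong T (fun z => ρ - y z * y z - u z * u z - 2 * z.2)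
      (-2 * u z * A z - 2) z := by
    have := (((hasAlong_const (X := T) (z := z) ρ).sub
      ((sm hy hz (hTy z hz)).mul (sm hy hz (hTy z hz)))).sub
      ((sm hu hz (hTu z hz)).mul (sm hu hz (hTu z hz)))).sub ((hasAlong_const 2).mul hasAlong_snd)
    refine ⟨this.1, this.2.trans ?_⟩
    rw [hT2 z hz]
    ring
  have hζC : ContDiffOn ℝ ∞ (fun z => ρ - y z * y z - u z * u z - 2 * z.2) Ω :=
    ((contDiffOn_const.sub (hy.mul hy)).sub (hu.mul hu)).sub (contDiffOn_const.mul contDiffOn_snd)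
  have hXζ₁ : HasAlong X (fun z => -2 * (y z + u z * w z))
      (-2 * (1 + w z ^ 2 + u z * ((1 + w z ^ 2) * A z))) z := by
    have := (hasAlong_const (X := X) (z := z) (-2)).mul ((sm hy hz (hXy z hz)).add
      ((sm hu hz (hXu z hz)).mul (sm hw hz (hXw z hz))))
    refine ⟨this.1, this.2.trans ?_⟩
    ring
  set ζ : ℝ × ℝ → ℝ := fun z => ρ - y z * y z - u z * u z - 2 * z.2 with hζdef
  set Φ : ℝ × ℝ → ℝ := fun z => (A z * A z) * (ζ z * ζ z) + M * κ * (w z * w z) with hΦ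
  have hΦC : ContDiffOn ℝ ∞ Φ Ω :=
    ((hA.mul hA).mul (hζC.mul hζC)).add (contDiffOn_const.mul (hw.mul hw))
  have hXΦ : ∀ z ∈ Ω, along X Φ z = 2 * (A z * along X A z) * (ζ z * ζ z) +
      (A z * A z) * (2 * (ζ z * (-2 * (y z + u z * w z)))) +
      M * κ * (2 * (w z * ((1 + w z * w z) * A z))) := fun z hz => by
    have hAz := sm (Y := X) hA hz rfl
    have hwz := sm hw hz (hXw z hz)
    refine (((hAz.mul hAz).mul ((hXζ z hz).mul (hXζ z hz))).add
      ((hasAlong_const (M * κ)).mul (hwz.mul hwz))).2.trans ?_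
    ring
  have hΦmax : ∀ᶠ z' in 𝓝 z, z'.2 ≤ z.2 → Φ z' ≤ Φ z := by
    filter_upwards [hmax] with z' h hz'
    have := h hz'
    simp only [hΦ]
    linarith
  have hsp : ∀ᶠ s in 𝓝 z.1, (s, z.2).2 ≤ z.2 → Φ (s, z.2) ≤ Φ z :=
    (show ContinuousAt (fun s => (s, z.2)) z.1 by fun_prop).eventually hΦmax
  have hti : ∀ᶠ s in 𝓝 z.2, (z.1, s).2 ≤ z.2 → Φ (z.1, s) ≤ Φ z :=
    (show ContinuousAt (fun s => (z.1, s)) z.2 by fun_prop).eventually hΦmax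
  obtain ⟨g0, g1, g2⟩ := along_conditions_of_isLocalMax hΩ hX hX2 hΦC hz
    (hsp.mono fun s hs => hs le_rfl)
  have g3 := along_nonneg_of_left_max (hT2 z hz) (differentiableAt_of_smooth hΩ hΦC hz) g0 hti
  have hAz := sm (Y := X) hA hz rfl
  have hA₁z := sm (Y := X) hA₁ hz rfl
  have hwz := sm hw hz (hXw z hz)
  have hζz := hXζ z hz
  rw [hXΦ z hz] at g1
  have e2 := ((((hasAlong_const 2).mul (hAz.mul hA₁z)).mul (hζz.mul hζz)).add
    ((hAz.mul hAz).mul ((hasAlong_const 2).mul (hζz.mul hXζ₁)))).add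
    ((hasAlong_const (M * κ)).mul ((hasAlong_const 2).mul
      (hwz.mul (((hasAlong_const 1).add (hwz.mul hwz)).mul hAz))))
  rw [along_congr hΩ hXΦ hz, e2.2] at g2
  have hATz := sm (Y := T) hA hz rfl
  have hwTz := sm hw hz (hTw z hz)
  rw [(((hATz.mul hATz).mul (hTζ.mul hTζ)).add
      ((hasAlong_const (M * κ)).mul (hwTz.mul hwTz))).2] at g3
  clear_value ζ Φ
  refine max_bound_algebra (w := w z) (q := 1 + w z ^ 2) (A := A z) (A₁ := along X A z)
    (A₂ := along X (along X A) z) (ζ := ζ z) (y := y z) (u := u z) (δA := along T A z)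
    (ζ₁ := -2 * (y z + u z * w z)) (by ring) hq hκ hM hζ0 ?_ hval hTA rfl ?_ ?_ ?_
  · have : ζ z = ρ - y z * y z - u z * u z - 2 * z.2 := congrFun hζdef z
    linarith
  · linarith
  · linarith
  · linarith

/-! ### The maximum principle for the flow -/

/-- The localization function `ζ = ρ - |γ - x₀|² - 2 t`, which solves the heat equation on the
moving curve. -/
def cutoff (γ : ℝ → ℝ → Plane) (x₀ : Plane) (ρ x t : ℝ) : ℝ :=
  ρ - (γ x t 0 - x₀ 0) * (γ x t 0 - x₀ 0) - (γ x t 1 - x₀ 1) * (γ x t 1 - x₀ 1) - 2 * t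

theorem cutoff_eq (γ : ℝ → ℝ → Plane) (x₀ : Plane) (ρ x t : ℝ) :
    cutoff γ x₀ ρ x t = ρ - dist (γ x t) x₀ ^ 2 - 2 * t := by
  rw [dist_eq_norm, norm_sq_plane, cutoff]
  simp only [PiLp.sub_apply]
  ring

section flow
variable {γ : ℝ → ℝ → Plane} {I : Set ℝ} {τ : ℝ}

theorem IsCurvatureFlow.contDiffOn_coord (h : IsCurvatureFlow γ I τ) (i : Fin 2) (c : ℝ) :
    ContDiffOn ℝ ∞ (fun z : ℝ × ℝ => γ z.1 z.2 i - c) (I ×ˢ Ioo 0 τ) := fun _ hz =>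
  ((contDiffAt_coord (h.smooth.contDiffAt ((h.isOpen.prod isOpen_Ioo).mem_nhds hz)) i).sub
    contDiffAt_const).contDiffWithinAt

theorem IsCurvatureFlow.along_horizontal (h : IsCurvatureFlow γ I τ) (i : Fin 2) (c : ℝ)
    {z : ℝ × ℝ} (hz : z ∈ I ×ˢ Ioo 0 τ) :
    along (fun _ => (1, 0)) (fun z : ℝ × ℝ => γ z.1 z.2 i - c) z = dx γ z.1 z.2 i :=
  (hasDerivAt_horizontal (differentiableAt_of_smooth (h.isOpen.prod isOpen_Ioo)
    (h.contDiffOn_coord i c) hz)).unique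
    ((hasDerivAt_coord (h.hasDerivAt_dx hz.1 ⟨hz.2.1.le, hz.2.2⟩) i).sub_const c)

theorem IsCurvatureFlow.along_vertical (h : IsCurvatureFlow γ I τ) (i : Fin 2) (c : ℝ)
    {z : ℝ × ℝ} (hz : z ∈ I ×ˢ Ioo 0 τ) :
    along (fun _ => (0, 1)) (fun z : ℝ × ℝ => γ z.1 z.2 i - c) z = dt γ z.1 z.2 i := by
  have hd : DifferentiableAt ℝ (fun z : ℝ × ℝ => γ z.1 z.2) (z.1, z.2) :=
    (h.smooth.contDiffAt ((h.isOpen.prod isOpen_Ioo).mem_nhds hz)).differentiableAt (by norm_num)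
  have h1 : HasDerivAt (fun s => γ z.1 s) _ z.2 := hd.hasFDerivAt.comp_hasDerivAt z.2
    ((hasDerivAt_const z.2 z.1).prodMk (hasDerivAt_id z.2))
  exact (hasDerivAt_vertical (differentiableAt_of_smooth (h.isOpen.prod isOpen_Ioo)
    (h.contDiffOn_coord i c) hz)).unique
    ((hasDerivAt_coord h1.differentiableAt.hasDerivAt i).sub_const c)

/-- `interior_max_bound` for a curvature flow, with `X = (1 / γ¹_x) ∂_x` and
`T = ∂_t - (γ¹_t / γ¹_x) ∂_x`, so that tangential motion plays no role. -/
theorem IsCurvatureFlow.interior_max_bound (h : IsCurvatureFlow γ I τ) {x₀ : Plane}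
    {z : ℝ × ℝ} {M V κ ρ : ℝ} (hz : z ∈ I ×ˢ Ioo 0 τ) (hp : dx γ z.1 z.2 0 ≠ 0)
    (hq : 1 + graphSlope γ z.1 z.2 ^ 2 ≤ V ^ 2) (hκ : κ * (2 * V ^ 2) = 1) (hM : 0 < M)
    (hζ0 : 0 < cutoff γ x₀ ρ z.1 z.2)
    (hval : angleRate γ z.1 z.2 ^ 2 * cutoff γ x₀ ρ z.1 z.2 ^ 2 =
      M * (1 - κ * (1 + graphSlope γ z.1 z.2 ^ 2)))
    (hmax : ∀ᶠ z' in 𝓝 z, z'.2 ≤ z.2 →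
      angleRate γ z'.1 z'.2 ^ 2 * cutoff γ x₀ ρ z'.1 z'.2 ^ 2 ≤
        M * (1 - κ * (1 + graphSlope γ z'.1 z'.2 ^ 2))) :
    M ≤ 640 * V ^ 4 * ρ := by
  have hU : IsOpen (I ×ˢ Ioo 0 τ) := h.isOpen.prod isOpen_Ioo
  set y : ℝ × ℝ → ℝ := fun z => γ z.1 z.2 0 - x₀ 0
  set u : ℝ × ℝ → ℝ := fun z => γ z.1 z.2 1 - x₀ 1
  have hyC : ContDiffOn ℝ ∞ y (I ×ˢ Ioo 0 τ) := h.contDiffOn_coord 0 _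
  have huC : ContDiffOn ℝ ∞ u (I ×ˢ Ioo 0 τ) := h.contDiffOn_coord 1 _
  have hyx : ∀ z ∈ I ×ˢ Ioo 0 τ, along (fun _ => (1, 0)) y z = dx γ z.1 z.2 0 :=
    fun z hz => h.along_horizontal 0 _ hz
  have hux : ∀ z ∈ I ×ˢ Ioo 0 τ, along (fun _ => (1, 0)) u z = dx γ z.1 z.2 1 :=
    fun z hz => h.along_horizontal 1 _ hz
  have hyt : ∀ z ∈ I ×ˢ Ioo 0 τ, along (fun _ => (0, 1)) y z = dt γ z.1 z.2 0 :=
    fun z hz => h.along_vertical 0 _ hz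
  have hut : ∀ z ∈ I ×ˢ Ioo 0 τ, along (fun _ => (0, 1)) u z = dt γ z.1 z.2 1 :=
    fun z hz => h.along_vertical 1 _ hz
  have hdxC : ∀ i, ContDiffOn ℝ ∞ (fun z : ℝ × ℝ => dx γ z.1 z.2 i) (I ×ˢ Ioo 0 τ) := fun i =>
    (contDiffOn_along hU contDiffOn_const (h.contDiffOn_coord i 0)).congr
      fun z hz => (h.along_horizontal i 0 hz).symm
  have hdtC : ContDiffOn ℝ ∞ (fun z : ℝ × ℝ => dt γ z.1 z.2 0) (I ×ˢ Ioo 0 τ) :=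
    (contDiffOn_along hU contDiffOn_const hyC).congr fun z hz => (hyt z hz).symm
  set Ω : Set (ℝ × ℝ) := (I ×ˢ Ioo 0 τ) ∩ (fun z : ℝ × ℝ => dx γ z.1 z.2 0) ⁻¹' {0}ᶜ
  have hΩ : IsOpen Ω := (hdxC 0).continuousOn.isOpen_inter_preimage hU isOpen_compl_singleton
  have hΩU : Ω ⊆ I ×ˢ Ioo 0 τ := inter_subset_left
  have hpΩ : ∀ z ∈ Ω, dx γ z.1 z.2 0 ≠ 0 := fun z hz => hz.2
  have hinv : ContDiffOn ℝ ∞ (fun z : ℝ × ℝ => (dx γ z.1 z.2 0)⁻¹) Ω :=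
    ((hdxC 0).mono hΩU).inv hpΩ
  set X : ℝ × ℝ → ℝ × ℝ := fun z => ((dx γ z.1 z.2 0)⁻¹, 0)
  set T : ℝ × ℝ → ℝ × ℝ := fun z => (-((dx γ z.1 z.2 0)⁻¹ * dt γ z.1 z.2 0), 1) with hTdef
  have hX : ContDiffOn ℝ ∞ X Ω := hinv.prodMk contDiffOn_const
  have hT : ContDiffOn ℝ ∞ T Ω := (hinv.mul (hdtC.mono hΩU)).neg.prodMk contDiffOn_const
  have hXf : ∀ (f : ℝ × ℝ → ℝ) (z : ℝ × ℝ),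
      along X f z = (dx γ z.1 z.2 0)⁻¹ * along (fun _ => (1, 0)) f z :=
    fun f z => along_eq_horizontal rfl
  have hTf : ∀ (f : ℝ × ℝ → ℝ) (z : ℝ × ℝ), along T f z = along (fun _ => (0, 1)) f z -
      (dx γ z.1 z.2 0)⁻¹ * dt γ z.1 z.2 0 * along (fun _ => (1, 0)) f z := by
    intro f z
    have : T z = (0, 1) - ((dx γ z.1 z.2 0)⁻¹ * dt γ z.1 z.2 0) • ((1 : ℝ), (0 : ℝ)) := by
      simp [hTdef]
    rw [along, this, map_sub, map_smul]
    rfl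
  have hTu : ∀ z ∈ Ω, along T u z = angleRate γ z.1 z.2 := fun z hz => by
    rw [hTf, hut z hz.1, hux z hz.1, ← velocity_eq hz.2 (h.motion _ hz.1.1 _ hz.1.2), graphSlope]
    ring
  refine CurveFlow.interior_max_bound (X := X) (T := T) (y := y) (u := u)
    (w := fun z => graphSlope γ z.1 z.2) (A := fun z => angleRate γ z.1 z.2)
    (ζ := fun z => cutoff γ x₀ ρ z.1 z.2) hΩ hX hT (hyC.mono hΩU) (huC.mono hΩU)
    (((hdxC 1).mono hΩU).div ((hdxC 0).mono hΩU) hpΩ)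
    ((contDiffOn_along hΩ hT (huC.mono hΩU)).congr fun z hz => (hTu z hz).symm)
    ?_ ?_ (fun _ _ => rfl) (fun _ _ => rfl) ?_ hTu ?_ (fun _ => rfl)
    ⟨hz, hp⟩ hz.2.1.le hq hκ hM hζ0 hval hmax
  · intro z hz
    rw [hXf, hyx z hz.1, inv_mul_cancel₀ hz.2]
  · intro z hz
    rw [hTf, hyx z hz.1, hyt z hz.1]
    have := hpΩ z hz
    field_simp
    ring
  · intro z hz
    rw [hXf, hux z hz.1, graphSlope]
    ring
  · intro z hz
    have hwC : ContDiffOn ℝ ∞ (fun z : ℝ × ℝ => graphSlope γ z.1 z.2) Ω :=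
      ((hdxC 1).mono hΩU).div ((hdxC 0).mono hΩU) hpΩ
    have e : along (fun _ => (1, 0)) (fun z : ℝ × ℝ => graphSlope γ z.1 z.2) z = _ :=
      (hasDerivAt_horizontal (differentiableAt_of_smooth hΩ hwC hz)).unique
        (h.hasDerivAt_graphSlope hz.1.1 ⟨hz.1.2.1.le, hz.1.2.2⟩ hz.2)
    rw [hXf, e]
    have := hpΩ z hz
    field_simp

/-- The weighted curvature `A² ζ² / (1 - κ v²)`, that is `k² φ(v²) ζ²` with `φ(s) = s / (1 - κ s)`.
-/
def weighted (γ : ℝ → ℝ → Plane) (x₀ : Plane) (κ ρ x t : ℝ) : ℝ :=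
  angleRate γ x t ^ 2 * cutoff γ x₀ ρ x t ^ 2 / (1 - κ * (1 + graphSlope γ x t ^ 2))

theorem IsCurvatureFlow.continuousOn_cutoff (h : IsCurvatureFlow γ I τ) (x₀ : Plane) (ρ : ℝ) :
    ContinuousOn (fun z : ℝ × ℝ => cutoff γ x₀ ρ z.1 z.2) (I ×ˢ Ico 0 τ) := by
  have h0 := continuousOn_coord h.continuousOn 0
  have h1 := continuousOn_coord h.continuousOn 1
  unfold cutoff
  fun_prop

theorem IsCurvatureFlow.continuousOn_weighted (h : IsCurvatureFlow γ I τ) {x₀ : Plane} {κ ρ : ℝ}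
    {S : Set (ℝ × ℝ)} (hS : S ⊆ I ×ˢ Ico 0 τ) (hp : ∀ z ∈ S, dx γ z.1 z.2 0 ≠ 0)
    (hm : ∀ z ∈ S, 1 - κ * (1 + graphSlope γ z.1 z.2 ^ 2) ≠ 0) :
    ContinuousOn (fun z : ℝ × ℝ => weighted γ x₀ κ ρ z.1 z.2) S := by
  have h0 := continuousOn_coord (h.continuousOn_dx.mono hS) 0
  have h1 := continuousOn_coord (h.continuousOn_dx.mono hS) 1
  have h00 := continuousOn_coord (h.continuousOn_dxx.mono hS) 0
  have h11 := continuousOn_coord (h.continuousOn_dxx.mono hS) 1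
  have hc := (h.continuousOn_cutoff x₀ ρ).mono hS
  have hA : ContinuousOn (fun z : ℝ × ℝ => angleRate γ z.1 z.2) S := by
    refine ContinuousOn.div (by fun_prop) (by fun_prop) fun z hz => ?_
    have := hp z hz
    positivity
  have hw : ContinuousOn (fun z : ℝ × ℝ => graphSlope γ z.1 z.2) S := h1.div h0 hp
  exact ContinuousOn.div (by fun_prop) (by fun_prop) hm

theorem mem_closedBall_of_cutoff_nonneg {x₀ : Plane} {ρ x t : ℝ} (ht : 0 ≤ t)
    (hc : 0 ≤ cutoff γ x₀ ρ x t) : γ x t ∈ Metric.closedBall x₀ (Real.sqrt ρ) := by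
  rw [cutoff_eq] at hc
  rw [Metric.mem_closedBall]
  apply Real.le_sqrt_of_sq_le
  linarith

/-- The weighted curvature attains its maximum over the part of the moving curve with `ζ ≥ 0`. The
compact set `K` of parameters covers this part as a point set only; by
`graphSlope_angleRate_eq_of_eq` a maximum over `K` is a maximum over all parameters. -/
theorem exists_max_weighted {x₀ : Plane} {R ρ κ x t V : ℝ} (hrR : Real.sqrt ρ < R)
    (h : IsCurvatureFlow γ I τ) (hg : IsGraphIn γ I τ x₀ R)
    (hV : ∀ x ∈ I, ∀ t ∈ Ico 0 τ, γ x t ∈ Metric.ball x₀ R →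
      dx γ x t 0 ≠ 0 ∧ 1 + graphSlope γ x t ^ 2 ≤ V ^ 2)
    (hm : ∀ {x t}, x ∈ I → t ∈ Ico 0 τ → 0 ≤ cutoff γ x₀ ρ x t →
      1 / 2 ≤ 1 - κ * (1 + graphSlope γ x t ^ 2))
    (ht : t ∈ Ico 0 τ) (hx : x ∈ I) (hcut : 0 ≤ cutoff γ x₀ ρ x t) :
    ∃ x₁ ∈ I, ∃ s ∈ Icc 0 t, 0 ≤ cutoff γ x₀ ρ x₁ s ∧
      ∀ y ∈ I, ∀ s' ∈ Icc 0 t, 0 ≤ cutoff γ x₀ ρ y s' →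
        weighted γ x₀ κ ρ y s' ≤ weighted γ x₀ κ ρ x₁ s := by
  have hball' : ∀ {x t}, 0 ≤ t → 0 ≤ cutoff γ x₀ ρ x t → γ x t ∈ Metric.ball x₀ R :=
    fun ht0 hc => Metric.closedBall_subset_ball hrR (mem_closedBall_of_cutoff_nonneg ht0 hc)
  obtain ⟨K, hK, hKI, hcover⟩ := hg.no_endpoint t ht.2 _ hrR
  have htτ : ∀ {s}, s ∈ Icc 0 t → s ∈ Ico 0 τ := fun hs => ⟨hs.1, hs.2.trans_lt ht.2⟩
  have hsub : K ×ˢ Icc 0 t ⊆ I ×ˢ Ico 0 τ := fun z hz => ⟨hKI hz.1, htτ hz.2⟩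
  have hcutC := (h.continuousOn_cutoff x₀ ρ).mono hsub
  set S : Set (ℝ × ℝ) := (K ×ˢ Icc 0 t) ∩ (fun z : ℝ × ℝ => cutoff γ x₀ ρ z.1 z.2) ⁻¹' Ici 0
  have hScompact : IsCompact S := (hK.prod isCompact_Icc).of_isClosed_subset
    (hcutC.preimage_isClosed_of_isClosed (hK.isClosed.prod isClosed_Icc) isClosed_Ici)
    inter_subset_left
  have hpS : ∀ z ∈ S, dx γ z.1 z.2 0 ≠ 0 := fun z hz =>
    (hV _ (hKI hz.1.1) _ (htτ hz.1.2) (hball' hz.1.2.1 hz.2)).1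
  have hFC : ContinuousOn (fun z : ℝ × ℝ => weighted γ x₀ κ ρ z.1 z.2) S :=
    h.continuousOn_weighted (inter_subset_left.trans hsub) hpS fun z hz =>
      (lt_of_lt_of_le one_half_pos (hm (hKI hz.1.1) (htτ hz.1.2) hz.2)).ne'
  -- the weighted function at a point of the disc only depends on the point of the plane
  have hrep : ∀ {x s}, x ∈ I → s ∈ Icc 0 t → 0 ≤ cutoff γ x₀ ρ x s →
      ∃ x' ∈ K, (x', s) ∈ S ∧ weighted γ x₀ κ ρ x s = weighted γ x₀ κ ρ x' s := by
    intro x s hx hs hc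
    obtain ⟨x', hx', hxx'⟩ := hcover s hs
      ⟨mem_image_of_mem _ hx, mem_closedBall_of_cutoff_nonneg hs.1 hc⟩
    have hxx : γ x' s = γ x s := hxx'
    have hc' : cutoff γ x₀ ρ x' s = cutoff γ x₀ ρ x s := by rw [cutoff, cutoff, hxx]
    have hc0 : 0 ≤ cutoff γ x₀ ρ x' s := hc'.symm ▸ hc
    obtain ⟨e1, e2⟩ := graphSlope_angleRate_eq_of_eq h hg (htτ hs) (hKI hx') hx hxx
      (hball' hs.1 hc) (hV _ (hKI hx') _ (htτ hs) (hball' hs.1 hc0)).1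
      (hV _ hx _ (htτ hs) (hball' hs.1 hc)).1
    exact ⟨x', hx', ⟨⟨hx', hs⟩, hc0⟩, by rw [weighted, weighted, e1, e2, hc']⟩
  obtain ⟨x', hx', hxS, -⟩ := hrep hx ⟨ht.1, le_rfl⟩ hcut
  obtain ⟨⟨x₁, s⟩, hzS, hzmax⟩ := hScompact.exists_isMaxOn ⟨_, hxS⟩ hFC
  rw [isMaxOn_iff] at hzmax
  refine ⟨x₁, hKI hzS.1.1, s, hzS.1.2, hzS.2, fun y hy s' hs' hc => ?_⟩
  obtain ⟨x', -, hx'S, e⟩ := hrep hy hs' hc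
  rw [e]
  exact hzmax (x', s') hx'S

/-- The curvature estimate with real numbers: the curvature is controlled by `1 / R²` or by the
initial curvature at some point of the disc. -/
theorem curvature_sq_le {x₀ : Plane} {R θ x t V : ℝ} (hR : 0 < R) (h : IsCurvatureFlow γ I τ)
    (hg : IsGraphIn γ I τ x₀ R)
    (hV : ∀ x ∈ I, ∀ t ∈ Ico 0 τ, γ x t ∈ Metric.ball x₀ R →
      dx γ x t 0 ≠ 0 ∧ 1 + graphSlope γ x t ^ 2 ≤ V ^ 2)
    (hθ : θ ∈ Ioo (0 : ℝ) 1) (ht : t ∈ Ico 0 τ) (hx : x ∈ I)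
    (hball : γ x t ∈ Metric.ball x₀ (Real.sqrt (θ * R ^ 2 - 2 * t))) :
    curvature γ x t ^ 2 ≤ 2560 * V ^ 4 / (1 - θ) ^ 2 * (1 / R ^ 2) ∨
    ∃ x₁ ∈ I, γ x₁ 0 ∈ Metric.ball x₀ R ∧
      curvature γ x t ^ 2 ≤ 2560 * V ^ 4 / (1 - θ) ^ 2 * curvature γ x₁ 0 ^ 2 := by
  obtain ⟨hθ0, hθ1⟩ := hθ
  have hR2 : 0 < R ^ 2 := by positivity
  have hθ' : 0 < 1 - θ := by linarith
  have hθ2 : 0 < (1 - θ) ^ 2 := by positivity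
  -- a radius `√ρ` strictly between `√θ R` and `R`: `no_endpoint` only covers smaller discs
  obtain ⟨ρ, hρ⟩ : ∃ ρ, ρ = (1 + θ) / 2 * R ^ 2 := ⟨_, rfl⟩
  have hρR : ρ < R ^ 2 := by
    rw [hρ]
    exact mul_lt_of_lt_one_left hR2 (by linarith)
  have hrR : Real.sqrt ρ < R := (Real.sqrt_lt' hR).2 hρR
  have hdist : dist (γ x t) x₀ ^ 2 < θ * R ^ 2 - 2 * t :=
    (Real.lt_sqrt dist_nonneg).1 (Metric.mem_ball.1 hball)
  have hcut : (1 - θ) / 2 * R ^ 2 < cutoff γ x₀ ρ x t := by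
    rw [cutoff_eq, hρ]
    linarith
  have hcut0 : 0 < cutoff γ x₀ ρ x t := lt_trans (by positivity) hcut
  have hball' : ∀ {x t}, 0 ≤ t → 0 ≤ cutoff γ x₀ ρ x t → γ x t ∈ Metric.ball x₀ R :=
    fun ht0 hc => Metric.closedBall_subset_ball hrR (mem_closedBall_of_cutoff_nonneg ht0 hc)
  obtain ⟨hp, hq⟩ := hV x hx t ht (hball' ht.1 hcut0.le)
  have hV1 : 1 ≤ V ^ 2 := le_trans (by linarith [sq_nonneg (graphSlope γ x t)]) hq
  obtain ⟨κ, hκ⟩ : ∃ κ, κ = 1 / (2 * V ^ 2) := ⟨_, rfl⟩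
  have hκ0 : 0 < κ := by rw [hκ]; positivity
  have hκV : κ * (2 * V ^ 2) = 1 := by rw [hκ]; exact div_mul_cancel₀ _ (by positivity)
  have hm : ∀ {x t}, x ∈ I → t ∈ Ico 0 τ → 0 ≤ cutoff γ x₀ ρ x t →
      1 / 2 ≤ 1 - κ * (1 + graphSlope γ x t ^ 2) := by
    intro x t hx ht hc
    have := mul_le_mul_of_nonneg_left (hV x hx t ht (hball' ht.1 hc)).2 hκ0.le
    linarith
  have htτ : ∀ {s}, s ∈ Icc 0 t → s ∈ Ico 0 τ := fun hs => ⟨hs.1, hs.2.trans_lt ht.2⟩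
  obtain ⟨x₁, hx₁, s, hs, hc₁, hzmax⟩ := exists_max_weighted hrR h hg hV hm ht hx hcut0.le
  obtain ⟨M, hMdef⟩ : ∃ M, M = weighted γ x₀ κ ρ x₁ s := ⟨_, rfl⟩
  have hleM : ∀ {x s}, x ∈ I → s ∈ Icc 0 t → 0 ≤ cutoff γ x₀ ρ x s →
      angleRate γ x s ^ 2 * cutoff γ x₀ ρ x s ^ 2 ≤ M * (1 - κ * (1 + graphSlope γ x s ^ 2)) :=
    fun hx hs hc => (div_le_iff₀ (by linarith [hm hx (htτ hs) hc])).1 (hMdef ▸ hzmax _ hx _ hs hc)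
  have hm₁ := hm hx₁ (htτ hs) hc₁
  have hval : angleRate γ x₁ s ^ 2 * cutoff γ x₀ ρ x₁ s ^ 2 =
      M * (1 - κ * (1 + graphSlope γ x₁ s ^ 2)) := by
    rw [hMdef, weighted, div_mul_cancel₀ _ (by linarith)]
  have hM0 : 0 ≤ M := by
    rw [hMdef, weighted]
    exact div_nonneg (by positivity) (by linarith)
  -- the bound on the curvature in terms of the maximum
  have hkM : curvature γ x t ^ 2 ≤ 4 / (1 - θ) ^ 2 * (M / R ^ 4) := by
    have h1 : curvature γ x t ^ 2 ≤ angleRate γ x t ^ 2 := by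
      rw [curvature_sq_eq hp]
      exact div_le_self (sq_nonneg _) (by linarith [sq_nonneg (graphSlope γ x t)])
    have h2 : angleRate γ x t ^ 2 * ((1 - θ) / 2 * R ^ 2) ^ 2 ≤ M := by
      have h3 : angleRate γ x t ^ 2 * ((1 - θ) / 2 * R ^ 2) ^ 2 ≤
          angleRate γ x t ^ 2 * cutoff γ x₀ ρ x t ^ 2 := by gcongr
      refine h3.trans ((hleM hx ⟨ht.1, le_rfl⟩ hcut0.le).trans (mul_le_of_le_one_right hM0 ?_))
      have : 0 < κ * (1 + graphSlope γ x t ^ 2) := by positivity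
      linarith
    refine h1.trans ?_
    rw [show 4 / (1 - θ) ^ 2 * (M / R ^ 4) = M / ((1 - θ) / 2 * R ^ 2) ^ 2 by field_simp; ring]
    rwa [le_div_iff₀ (by positivity)]
  rcases hs.1.eq_or_lt with hs0 | hs0
  · -- the maximum is attained at the initial time
    subst hs0
    right
    refine ⟨x₁, hx₁, hball' le_rfl hc₁, hkM.trans ?_⟩
    obtain ⟨hp₁, hq₁⟩ := hV x₁ hx₁ 0 (htτ hs) (hball' le_rfl hc₁)
    have hA : angleRate γ x₁ 0 ^ 2 ≤ V ^ 2 * curvature γ x₁ 0 ^ 2 := by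
      have : angleRate γ x₁ 0 ^ 2 = (1 + graphSlope γ x₁ 0 ^ 2) * curvature γ x₁ 0 ^ 2 := by
        rw [curvature_sq_eq hp₁]
        field_simp
      rw [this]
      gcongr
    have hcR : cutoff γ x₀ ρ x₁ 0 ≤ R ^ 2 := by
      rw [cutoff_eq]
      linarith [sq_nonneg (dist (γ x₁ 0) x₀)]
    have hMk : M / R ^ 4 ≤ 2 * V ^ 2 * curvature γ x₁ 0 ^ 2 := by
      rw [div_le_iff₀ (by positivity)]
      have h1 : angleRate γ x₁ 0 ^ 2 * cutoff γ x₀ ρ x₁ 0 ^ 2 ≤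
          V ^ 2 * curvature γ x₁ 0 ^ 2 * (R ^ 2) ^ 2 := by gcongr
      have h2 := mul_le_mul_of_nonneg_left hm₁ hM0
      linarith
    have hV4 : 8 * V ^ 2 ≤ 2560 * V ^ 4 := by nlinarith
    calc 4 / (1 - θ) ^ 2 * (M / R ^ 4)
        ≤ 4 / (1 - θ) ^ 2 * (2 * V ^ 2 * curvature γ x₁ 0 ^ 2) := by gcongr
      _ = 8 * V ^ 2 / (1 - θ) ^ 2 * curvature γ x₁ 0 ^ 2 := by ring
      _ ≤ _ := by gcongr
  · left
    have hMρ : M ≤ 640 * V ^ 4 * R ^ 2 := by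
      rcases hM0.eq_or_lt with h0 | hMpos
      · rw [← h0]
        positivity
      have hc₁' : 0 < cutoff γ x₀ ρ x₁ s := by
        refine hc₁.lt_of_ne fun h0 => ?_
        rw [← h0] at hval
        have : 0 < M * (1 - κ * (1 + graphSlope γ x₁ s ^ 2)) :=
          mul_pos hMpos (by linarith)
        norm_num at hval
        rcases hval with h | h <;> linarith
      have hz : (x₁, s) ∈ I ×ˢ Ioo 0 τ := ⟨hx₁, hs0, (htτ hs).2⟩
      have hUo : IsOpen (I ×ˢ Ioo 0 τ) := h.isOpen.prod isOpen_Ioo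
      have hpos : ∀ᶠ z' : ℝ × ℝ in 𝓝 (x₁, s), 0 < cutoff γ x₀ ρ z'.1 z'.2 := by
        have : ContinuousAt (fun z : ℝ × ℝ => cutoff γ x₀ ρ z.1 z.2) (x₁, s) := by
          have h0 := ((h.contDiffOn_coord 0 (x₀ 0)).continuousOn.continuousAt (hUo.mem_nhds hz))
          have h1 := ((h.contDiffOn_coord 1 (x₀ 1)).continuousOn.continuousAt (hUo.mem_nhds hz))
          unfold cutoff
          fun_prop
        exact this.eventually (lt_mem_nhds hc₁')
      refine le_trans (h.interior_max_bound (x₀ := x₀) hz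
        (hV _ hx₁ _ (htτ hs) (hball' hs.1 hc₁)).1 (hV _ hx₁ _ (htτ hs) (hball' hs.1 hc₁)).2 hκV
        hMpos hc₁' hval ?_) (by gcongr : 640 * V ^ 4 * ρ ≤ 640 * V ^ 4 * R ^ 2)
      filter_upwards [hpos, hUo.mem_nhds hz] with z' h1 h2 h3
      exact hleM h2.1 ⟨h2.2.1.le, h3.trans hs.2⟩ h1.le
    refine hkM.trans ?_
    calc 4 / (1 - θ) ^ 2 * (M / R ^ 4)
        ≤ 4 / (1 - θ) ^ 2 * (640 * V ^ 4 * R ^ 2 / R ^ 4) := by gcongr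
      _ = _ := by
        field_simp
        ring

end flow

end CurveFlow

end

theorem mainTheorem8 (V : ℝ≥0) :
    ∃ C : ℝ≥0, ∀ (x₀ : Plane) (R τ : ℝ) (I : Set ℝ) (γ : ℝ → ℝ → Plane),
      0 < R → 0 < τ →
      CurveFlow.IsCurvatureFlow γ I τ →
      CurveFlow.IsGraphIn γ I τ x₀ R →
      CurveFlow.supGradientFn γ I τ (Metric.ball x₀ R) ≤ (V : ℝ≥0∞) →
      ∀ θ ∈ Set.Ioo (0 : ℝ) 1, ∀ t ∈ Set.Ico (0 : ℝ) τ,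
        CurveFlow.supCurvatureSq γ I t (Metric.ball x₀ (Real.sqrt (θ * R ^ 2 - 2 * t))) ≤
          ENNReal.ofReal (C / (1 - θ) ^ 2) *
            (ENNReal.ofReal (1 / R ^ 2) +
              CurveFlow.supCurvatureSq γ I 0 (Metric.ball x₀ R)) := by
  refine ⟨2560 * V ^ 4, fun x₀ R τ I γ hR _ h hg hsup θ hθ t ht => iSup₂_le fun x hx => ?_⟩
  have hV : ∀ x ∈ I, ∀ t ∈ Set.Ico 0 τ, γ x t ∈ Metric.ball x₀ R →
      CurveFlow.dx γ x t 0 ≠ 0 ∧ 1 + CurveFlow.graphSlope γ x t ^ 2 ≤ (V : ℝ) ^ 2 :=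
    fun x hx t ht hb => CurveFlow.graphSlope_bound
      (((le_iSup₂_of_le t ht (le_iSup₂_of_le x ⟨hx, hb⟩ le_rfl)) :
        _ ≤ CurveFlow.supGradientFn γ I τ (Metric.ball x₀ R)).trans hsup)
  have hC : (0 : ℝ) ≤ 2560 * V ^ 4 / (1 - θ) ^ 2 := by positivity
  push_cast
  rcases CurveFlow.curvature_sq_le hR h hg hV hθ ht hx.1 hx.2 with hk | ⟨x₁, hx₁, hb, hk⟩
  · refine (ENNReal.ofReal_le_ofReal hk).trans ?_
    rw [ENNReal.ofReal_mul hC]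
    gcongr
    exact le_self_add
  · refine (ENNReal.ofReal_le_ofReal hk).trans ?_
    rw [ENNReal.ofReal_mul hC]
    gcongr
    exact le_add_left (le_iSup₂_of_le (f := fun x (_ : x ∈ {x ∈ I | γ x 0 ∈ Metric.ball x₀ R}) =>
      ENNReal.ofReal (CurveFlow.curvature γ x 0 ^ 2)) x₁ ⟨hx₁, hb⟩ le_rfl)
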